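/- Let $n\ge 0$ and let $\mathcal M$ be an $[n]$-manifold over a smooth manifold $M$: a sheaf $\mathcal C^\infty(\mathcal M)$ on $M$ of $\mathbb N$-graded, graded commutative, associative, unital $C^\infty(M)$-algebras which is locally freely generated by finitely many elements of degrees $1,\dots,n$. Vector fields of degree $j$ on $\mathcal M$ are the degree $j$ graded derivations of $\mathcal C^\infty(\mathcal M)$; they form the graded sheaf $\mathfrak X(\mathcal M)$, with the graded commutator $[\cdot\,,\cdot]$. One-forms of degree $p$ are the functions of bidegree $(p,1)$ on the shifted tangent bundle $T[1]\mathcal M$ (total degree $p+1$), equivalently the elements of the dual of $\mathfrak X(\mathcal M)$; they form the graded sheaf $\Omega^1(\mathcal M)$, and $\mathrm d\xi$ has degree $|\xi|$. All degrees $|\cdot|$ of one-forms below are these degrees $p$. Let $\mathcal Q$ be a homological vector field on $\mathcal M$ (a vector field of degree $1$ with $\mathcal Q^2=0$), and let $\{\cdot\,,\cdot\}$ be a degree $-n$ Poisson bracket on $\mathcal M$, i.e. an $\mathbb R$-bilinear operation with $|\{\xi_1,\xi_2\}|=|\xi_1|+|\xi_2|-n$, $\{\xi_1,\xi_2\}=-(-1)^{(|\xi_1|-n)(|\xi_2|-n)}\{\xi_2,\xi_1\}$,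 $\{\xi_1,\xi_2\xi_3\}=\{\xi_1,\xi_2\}\xi_3+(-1)^{(|\xi_1|-n)|\xi_2|}\xi_2\{\xi_1,\xi_3\}$ and $\{\xi_1,\{\xi_2,\xi_3\}\}=\{\{\xi_1,\xi_2\},\xi_3\}+(-1)^{(|\xi_1|-n)(|\xi_2|-n)}\{\xi_2,\{\xi_1,\xi_3\}\}$. One calls $(\mathcal M,\mathcal Q,\{\cdot\,,\cdot\})$ a Poisson Lie $n$-algebroid if $\mathcal Q$ and the bracket are compatible: $$\mathcal Q\{\xi_1,\xi_2\}=\{\mathcal Q(\xi_1),\xi_2\}+(-1)^{|\xi_1|-n}\{\xi_1,\mathcal Q(\xi_2)\}.$$ The Lie derivative $L_{\mathcal Q}$ is $[\mathcal Q,\cdot]$ on $\mathfrak X(\mathcal M)$, and on $\Omega^1(\mathcal M)$ it is the degree $1$ operator with $L_{\mathcal Q}(\mathrm d\xi)=-\mathrm d(\mathcal Q\xi)$ and $L_{\mathcal Q}(\xi\theta)=\mathcal Q(\xi)\theta+(-1)^{|\xi|}\xi L_{\mathcal Q}\theta$. The adjoint module is $(\mathfrak X(\mathcal M),L_{\mathcal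 Q})$, both as a left DG $\mathcal M$-module, with $(\xi X)(\zeta)=\xi X(\zeta)$, and as a right DG $\mathcal M$-module, with $X\xi=(-1)^{|\xi||X|}\xi X$. The coadjoint module is $(\Omega^1(\mathcal M),L_{\mathcal Q})$ as a left DG $\mathcal M$-module and $(\Omega^1(\mathcal M),-L_{\mathcal Q})$ as a right DG $\mathcal M$-module, with $\theta\xi=(-1)^{|\xi|(|\theta|+1)}\xi\theta$. A degree $k$ (anti-)morphism $E\to F$ is a degree preserving (anti-)morphism $E\to F[k]$, where $F[k]=F\otimes\mathbb R[k]$ has $F[k]^i=F^{i+k}$, the differential and left multiplication of $F$, and right multiplication $(-1)^{k|\xi|}\eta\xi$. A morphism of right DG modules is a right linear map which commutes with the differentials; an anti-morphism of left DG modules is a map which is odd linear, $f(\xi\eta)=(-1)^{|\xi|}\xi f(\eta)$, and anticommutes with the differentials. Let $\sharp\colon\Omega^1(\mathcal M)\to\mathfrak X(\mathcal M)$ be the degree $-n$ map given by $\sharp(\mathrm d\xi)=\{\xi,\cdot\}$ and $\sharp(\xi\theta)=(-1)^{|\xi|}\xi\,\sharp(\theta)$. **Theorem.** The following are equivalent: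 1. $(\mathcal M,\mathcal Q,\{\cdot\,,\cdot\})$ is a Poisson Lie $n$-algebroid; 2. $\sharp$ is a degree $-n$ anti-morphism of left DG $\mathcal M$-modules from the coadjoint to the adjoint module; 3. $\sharp$ is a degree $-n$ morphism of right DG $\mathcal M$-modules from the coadjoint to the adjoint module; 4. $\sharp\circ L_{\mathcal Q}=-L_{\mathcal Q}\circ\sharp$. -/

import Mathlib

open TopologicalSpace
open scoped Manifold ContDiff DirectSum

noncomputable section

namespace GradedGeometry

/-! ### Koszul signs -/

/-- The Koszul sign `(-1)^k`. -/
def sgn (k : ℤ) : ℝ := (-1 : ℝ) ^ k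

theorem sgn_add (a b : ℤ) : sgn (a + b) = sgn a * sgn b :=
  zpow_add₀ (by norm_num) a b

theorem sgn_congr {a b : ℤ} (h : Even a ↔ Even b) : sgn a = sgn b := by
  unfold sgn
  rcases Int.even_or_odd a with ha | ha
  · rw [ha.neg_one_zpow, (h.1 ha).neg_one_zpow]
  · have hb : Odd b := by
      rw [← Int.not_even_iff_odd] at ha ⊢
      exact fun hb => ha (h.2 hb)
    rw [ha.neg_one_zpow, hb.neg_one_zpow]

theorem neg_sgn (a : ℤ) : -sgn a = sgn (a + 1) := by
  rw [sgn_add]; simp [sgn]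

theorem sgn_even {a : ℤ} (h : Even a) : sgn a = 1 := h.neg_one_zpow

/-! ### `[n]`-manifolds -/

section Manifold

universe u v

variable {m : ℕ}

/-- The ordered monomial `∏ ξ_i^j ^ α_i^j` in generators `ξ_i^j` of a ring. -/
def monomial {n : ℕ} {r : Fin n → ℕ} {R : Type v} [Ring R]
    (gen : (i : Fin n) → Fin (r i) → R) (α : (i : Fin n) → Fin (r i) → ℕ) : R :=
  ((List.finRange n).map fun i =>
    ((List.finRange (r i)).map fun j => gen i j ^ α i j).prod).prod

/-- The exponents of the monomials which form a basis of a free graded commutative algebra on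
generators `ξ_i^j`, where `i : Fin n` stands for the degree `i + 1`: generators of odd degree occur
at most once. -/
def Exponent {n : ℕ} (r : Fin n → ℕ) : Type :=
  {α : (i : Fin n) → Fin (r i) → ℕ // ∀ (i : Fin n) (j : Fin (r i)), Odd ((i : ℕ) + 1) → α i j ≤ 1}

/-- The smooth real functions on an open subset of `M`. -/
abbrev Smooth {M : Type u} [TopologicalSpace M] [ChartedSpace (EuclideanSpace ℝ (Fin m)) M]
    (U : Opens M) : Type u :=
  C^∞⟮𝓡 m, U; 𝓘(ℝ), ℝ⟯

/-- An `[n]`-manifold, i.e. an `ℕ`-manifold of degree `n`, of dimension `(m; r 0, …, r (n-1))`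
over a smooth `m`-dimensional manifold `M`: a sheaf of graded commutative associative unital
`C^∞(M)`-algebras, locally freely generated by `r i` elements of degree `i + 1`, for `i : Fin n`.
The grading is indexed by `ℤ` and vanishes in negative degrees. -/
structure NManifold {n : ℕ} (r : Fin n → ℕ) (M : Type u) [TopologicalSpace M]
    [ChartedSpace (EuclideanSpace ℝ (Fin m)) M] where
  /-- functions over an open set -/
  sec : Opens M → Type v
  [ring : ∀ U, Ring (sec U)]
  [algebra : ∀ U, Algebra ℝ (sec U)]
  /-- functions of a given degree -/
  deg : ∀ U, ℤ → Submodule ℝ (sec U)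
  [graded : ∀ U, GradedAlgebra (deg U)]
  deg_neg : ∀ U k, k < 0 → deg U k = ⊥
  comm : ∀ U a b, ∀ ξ ∈ deg U a, ∀ ζ ∈ deg U b, ξ * ζ = sgn (a * b) • (ζ * ξ)
  /-- restriction to a smaller open set -/
  res : ∀ {U V : Opens M}, V ≤ U → (sec U →ₐ[ℝ] sec V)
  res_mem : ∀ {U V : Opens M} (h : V ≤ U) (k : ℤ), ∀ ξ ∈ deg U k, res h ξ ∈ deg V k
  res_id : ∀ (U : Opens M) (ξ : sec U), res le_rfl ξ = ξ
  res_res : ∀ {U V W : Opens M} (h : V ≤ U) (h' : W ≤ V) (ξ : sec U),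
    res h' (res h ξ) = res (h'.trans h) ξ
  /-- every homogeneous component is a sheaf -/
  glue : ∀ (𝒰 : Set (Opens M)) (k : ℤ) (s : ∀ V : 𝒰, sec V.1), (∀ V, s V ∈ deg V.1 k) →
    (∀ V W : 𝒰, res (inf_le_left : V.1 ⊓ W.1 ≤ V.1) (s V) =
      res (inf_le_right : V.1 ⊓ W.1 ≤ W.1) (s W)) →
    ∃! t : sec (sSup 𝒰), t ∈ deg (sSup 𝒰) k ∧ ∀ V : 𝒰, res (le_sSup V.2) t = s V
  /-- the structure of an algebra over the sheaf of smooth functions on `M` -/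
  smooth : ∀ U : Opens M, Smooth (m := m) U →ₐ[ℝ] sec U
  smooth_mem : ∀ U f, smooth U f ∈ deg U 0
  res_smooth : ∀ {U V : Opens M} (h : V ≤ U) (f : Smooth (m := m) U),
    res h (smooth U f) =
      smooth V (ContMDiffMap.restrictRingHom (𝓡 m) 𝓘(ℝ) (n := ∞) ℝ h f)
  /-- around every point there are generators such that every function on a smaller open set is
  in a unique way a combination of their monomials, with smooth coefficients -/
  locally_free : ∀ x : M, ∃ U : Opens M, x ∈ U ∧ ∃ gen : (i : Fin n) → Fin (r i) → sec U,
    (∀ (i : Fin n) (j : Fin (r i)), gen i j ∈ deg U ((i : ℕ) + 1)) ∧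
    ∀ (V : Opens M) (h : V ≤ U), Function.Bijective
      fun c : Exponent r →₀ Smooth (m := m) V =>
        c.sum fun α f => smooth V f * monomial (fun i j => res h (gen i j)) α.1

attribute [instance] NManifold.ring NManifold.algebra NManifold.graded

namespace NManifold

variable {n : ℕ} {r : Fin n → ℕ} {M : Type u} [TopologicalSpace M]
  [ChartedSpace (EuclideanSpace ℝ (Fin m)) M] (A : NManifold.{u, v} (m := m) r M)

theorem mul_mem {U : Opens M} {a b : ℤ} {ξ ζ : A.sec U} (hξ : ξ ∈ A.deg U a)
    (hζ : ζ ∈ A.deg U b) : ξ * ζ ∈ A.deg U (a + b) :=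
  SetLike.mul_mem_graded hξ hζ

/-- the unit, as a function of degree `0` -/
def one (U : Opens M) : A.deg U 0 := ⟨1, SetLike.one_mem_graded (A.deg U)⟩

/-- the product of homogeneous functions -/
def mul {U : Opens M} {a b : ℤ} (ξ : A.deg U a) (ζ : A.deg U b) : A.deg U (a + b) :=
  ⟨ξ.1 * ζ.1, A.mul_mem ξ.2 ζ.2⟩

/-- restriction of homogeneous functions -/
def resDeg {U V : Opens M} (h : V ≤ U) (k : ℤ) : A.deg U k →ₗ[ℝ] A.deg V k :=
  (A.res h).toLinearMap.restrict (A.res_mem h k)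

theorem hom_ext {U : Opens M} {N : Type*} [AddCommGroup N] [Module ℝ N]
    {f g : A.sec U →ₗ[ℝ] N} (h : ∀ a, ∀ ξ ∈ A.deg U a, f ξ = g ξ) : f = g := by
  ext ξ
  induction ξ using DirectSum.Decomposition.inductionOn (A.deg U) with
  | zero => simp
  | homogeneous ξ => exact h _ _ ξ.2
  | add a b ha hb => simp [ha, hb]

theorem le_base {U : Opens M} (V : Set.Iic U) : V.1 ≤ U := V.2

/-! ### Vector fields -/

/-- Families of linear endomorphisms of the spaces of functions over all open subsets of `U`. -/
def PreVF (U : Opens M) := ∀ V : Set.Iic U, Module.End ℝ (A.sec V.1)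

instance (U : Opens M) : AddCommGroup (A.PreVF U) := inferInstanceAs (AddCommGroup (∀ V : Set.Iic U, Module.End ℝ (A.sec V.1)))

instance (U : Opens M) : Module ℝ (A.PreVF U) := inferInstanceAs (Module ℝ (∀ V : Set.Iic U, Module.End ℝ (A.sec V.1)))

namespace PreVF

variable {A} {U : Opens M}

variable (A) in
/-- a family as an element of `PreVF` -/
def of (f : ∀ V : Set.Iic U, Module.End ℝ (A.sec V.1)) : A.PreVF U := f

@[simp] theorem of_apply (f : ∀ V : Set.Iic U, Module.End ℝ (A.sec V.1))
    (V : Set.Iic U) : of A f V = f V := rfl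

@[ext] theorem ext {X Y : A.PreVF U} (h : ∀ V, X V = Y V) : X = Y := funext h

@[simp] theorem zero_apply (V : Set.Iic U) : (0 : A.PreVF U) V = 0 := rfl

@[simp] theorem add_apply (X Y : A.PreVF U) (V : Set.Iic U) : (X + Y) V = X V + Y V := rfl

@[simp] theorem sub_apply (X Y : A.PreVF U) (V : Set.Iic U) : (X - Y) V = X V - Y V := rfl

@[simp] theorem neg_apply (X : A.PreVF U) (V : Set.Iic U) : (-X) V = -X V := rfl

@[simp] theorem smul_apply (c : ℝ) (X : A.PreVF U) (V : Set.Iic U) :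
    (c • X) V = c • X V := rfl

end PreVF

/-- The vector fields of degree `j` over `U`: the degree `j` graded derivations of the sheaf of
functions on `U`. -/
def vf (U : Opens M) (j : ℤ) : Submodule ℝ (A.PreVF U) where
  carrier := {X |
    (∀ (V W : Set.Iic U) (h : W.1 ≤ V.1) (ξ : A.sec V.1), X W (A.res h ξ) = A.res h (X V ξ)) ∧
    (∀ (V : Set.Iic U) (a : ℤ), ∀ ξ ∈ A.deg V.1 a, X V ξ ∈ A.deg V.1 (j + a)) ∧
    (∀ (V : Set.Iic U) (a : ℤ), ∀ ξ ∈ A.deg V.1 a, ∀ ζ : A.sec V.1,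
      X V (ξ * ζ) = X V ξ * ζ + sgn (j * a) • (ξ * X V ζ))}
  zero_mem' := by simp
  add_mem' := by
    rintro X Y ⟨h1, h2, h3⟩ ⟨k1, k2, k3⟩
    refine ⟨fun V W h ξ => ?_, fun V a ξ hξ => ?_, fun V a ξ hξ ζ => ?_⟩
    · simp [h1 V W h, k1 V W h]
    · exact add_mem (h2 V a ξ hξ) (k2 V a ξ hξ)
    · simp only [PreVF.add_apply, LinearMap.add_apply, h3 V a ξ hξ, k3 V a ξ hξ, add_mul, mul_add,
        smul_add]
      abel
  smul_mem' := by
    rintro c X ⟨h1, h2, h3⟩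
    refine ⟨fun V W h ξ => ?_, fun V a ξ hξ => ?_, fun V a ξ hξ ζ => ?_⟩
    · simp [h1 V W h]
    · exact Submodule.smul_mem _ _ (h2 V a ξ hξ)
    · simp only [PreVF.smul_apply, LinearMap.smul_apply, h3 V a ξ hξ, smul_add, smul_mul_assoc,
        mul_smul_comm]
      rw [smul_comm c]

/-- restriction of families of endomorphisms to a smaller open set -/
def resPreVF {U V : Opens M} (h : V ≤ U) : A.PreVF U →ₗ[ℝ] A.PreVF V where
  toFun X := PreVF.of A fun W => X ⟨W.1, le_trans W.2 h⟩
  map_add' _ _ := rfl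
  map_smul' _ _ := rfl

theorem resPreVF_mem {U V : Opens M} (h : V ≤ U) (j : ℤ) : ∀ X ∈ A.vf U j,
    A.resPreVF h X ∈ A.vf V j := by
  rintro X ⟨h1, h2, h3⟩
  exact ⟨fun W W' hW ξ => h1 ⟨W.1, le_trans W.2 h⟩ ⟨W'.1, le_trans W'.2 h⟩ hW ξ,
    fun W a ξ hξ => h2 ⟨W.1, le_trans W.2 h⟩ a ξ hξ,
    fun W a ξ hξ ζ => h3 ⟨W.1, le_trans W.2 h⟩ a ξ hξ ζ⟩

/-- restriction of vector fields to a smaller open set -/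
def resVF {U V : Opens M} (h : V ≤ U) (j : ℤ) : A.vf U j →ₗ[ℝ] A.vf V j :=
  (A.resPreVF h).restrict (A.resPreVF_mem h j)

variable {A}

/-- the action of a vector field over `U` on the functions over `U` -/
def ap {U : Opens M} {j : ℤ} (X : A.vf U j) : Module.End ℝ (A.sec U) :=
  X.1 ⟨U, le_refl U⟩

theorem ap_mem {U : Opens M} {j : ℤ} (X : A.vf U j) {a : ℤ} {ξ : A.sec U} (hξ : ξ ∈ A.deg U a) :
    ap X ξ ∈ A.deg U (j + a) := X.2.2.1 ⟨U, le_refl U⟩ a ξ hξ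

theorem ap_mul {U : Opens M} {j : ℤ} (X : A.vf U j) {a : ℤ} {ξ : A.sec U} (hξ : ξ ∈ A.deg U a)
    (ζ : A.sec U) : ap X (ξ * ζ) = ap X ξ * ζ + sgn (j * a) • (ξ * ap X ζ) :=
  X.2.2.2 ⟨U, le_refl U⟩ a ξ hξ ζ

theorem ap_res {U V : Opens M} (h : V ≤ U) {j : ℤ} (X : A.vf U j) (ξ : A.sec U) :
    ap (A.resVF h j X) (A.res h ξ) = A.res h (ap X ξ) :=
  X.2.1 ⟨U, le_refl U⟩ ⟨V, h⟩ h ξ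

variable (A)

/-- The left multiplication of vector fields by functions, `(ξ X)(ζ) = ξ X(ζ)`. -/
def smulVF (U : Opens M) (a j : ℤ) : A.deg U a →ₗ[ℝ] A.vf U j →ₗ[ℝ] A.vf U (a + j) :=
  LinearMap.mk₂ ℝ
    (fun ξ X => ⟨PreVF.of A fun V => LinearMap.mulLeft ℝ (A.res (le_base V) ξ.1) * X.1 V, by
      obtain ⟨h1, h2, h3⟩ := X.2
      refine ⟨fun V W h ζ => ?_, fun V b ζ hζ => ?_, fun V b ζ hζ η => ?_⟩
      · simp only [PreVF.of_apply, Module.End.mul_apply, LinearMap.mulLeft_apply, map_mul, A.res_res, h1 V W h]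
      · rw [add_assoc]
        exact A.mul_mem (A.res_mem _ _ _ ξ.2) (h2 V b ζ hζ)
      · simp only [PreVF.of_apply, Module.End.mul_apply, LinearMap.mulLeft_apply, h3 V b ζ hζ, mul_add,
          mul_smul_comm, ← mul_assoc]
        rw [A.comm _ a b _ (A.res_mem (le_base V) _ _ ξ.2) ζ hζ, add_mul, sgn_add, smul_mul_assoc, smul_smul,
          mul_comm (sgn (a * b))]⟩)
    (fun ξ ξ' X => by ext V ζ; simp [add_mul])
    (fun c ξ X => by ext V ζ; simp)
    (fun ξ X X' => by ext V ζ; simp [mul_add])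
    (fun c ξ X => by ext V ζ; simp)

theorem smulVF_apply (U : Opens M) (a j : ℤ) (ξ : A.deg U a) (X : A.vf U j) (V : Set.Iic U)
    (ζ : A.sec V.1) :
    (A.smulVF U a j ξ X).1 V ζ = A.res (le_base V) ξ.1 * X.1 V ζ := rfl

/-! ### Differential forms of degree one -/

/-- Families of functionals on the vector fields over all open subsets of `U`. -/
def PreForm (U : Opens M) := ∀ V : Set.Iic U, ∀ j : ℤ, A.vf V.1 j →ₗ[ℝ] A.sec V.1

instance (U : Opens M) : AddCommGroup (A.PreForm U) := inferInstanceAs (AddCommGroup (∀ V : Set.Iic U, ∀ j : ℤ, A.vf V.1 j →ₗ[ℝ] A.sec V.1))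

instance (U : Opens M) : Module ℝ (A.PreForm U) := inferInstanceAs (Module ℝ (∀ V : Set.Iic U, ∀ j : ℤ, A.vf V.1 j →ₗ[ℝ] A.sec V.1))

namespace PreForm

variable {A} {U : Opens M}

variable (A) in
/-- a family as an element of `PreForm` -/
def of (f : ∀ V : Set.Iic U, ∀ j : ℤ, A.vf V.1 j →ₗ[ℝ] A.sec V.1) : A.PreForm U := f

@[simp] theorem of_apply (f : ∀ V : Set.Iic U, ∀ j : ℤ, A.vf V.1 j →ₗ[ℝ] A.sec V.1)
    (V : Set.Iic U) : of A f V = f V := rfl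

@[ext] theorem ext {X Y : A.PreForm U} (h : ∀ V, X V = Y V) : X = Y := funext h

@[simp] theorem zero_apply (V : Set.Iic U) : (0 : A.PreForm U) V = 0 := rfl

@[simp] theorem add_apply (X Y : A.PreForm U) (V : Set.Iic U) : (X + Y) V = X V + Y V := rfl

@[simp] theorem sub_apply (X Y : A.PreForm U) (V : Set.Iic U) : (X - Y) V = X V - Y V := rfl

@[simp] theorem neg_apply (X : A.PreForm U) (V : Set.Iic U) : (-X) V = -X V := rfl

@[simp] theorem smul_apply (c : ℝ) (X : A.PreForm U) (V : Set.Iic U) :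
    (c • X) V = c • X V := rfl

end PreForm

/-- The one-forms of degree `p` over `U`, i.e. the functions of bidegree `(p, 1)` on the shifted
tangent bundle, as elements of the dual of the sheaf of vector fields: a form `θ` is
identified with the contractions `θ(X) = i_X θ`, which satisfy `i_{ξX} θ = ξ i_X θ`. -/
def forms (U : Opens M) (p : ℤ) : Submodule ℝ (A.PreForm U) where
  carrier := {θ |
    (∀ (V W : Set.Iic U) (h : W.1 ≤ V.1) (j : ℤ) (X : A.vf V.1 j),
      θ W j (A.resVF h j X) = A.res h (θ V j X)) ∧
    (∀ (V : Set.Iic U) (j : ℤ) (X : A.vf V.1 j), θ V j X ∈ A.deg V.1 (p + j)) ∧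
    (∀ (V : Set.Iic U) (a j : ℤ) (ξ : A.deg V.1 a) (X : A.vf V.1 j),
      θ V (a + j) (A.smulVF V.1 a j ξ X) = ξ.1 * θ V j X)}
  zero_mem' := by simp
  add_mem' := by
    rintro X Y ⟨h1, h2, h3⟩ ⟨k1, k2, k3⟩
    refine ⟨fun V W h j ξ => ?_, fun V a ξ => ?_, fun V a j ξ ζ => ?_⟩
    · simp [h1 V W h, k1 V W h]
    · exact add_mem (h2 V a ξ) (k2 V a ξ)
    · simp [h3, k3, mul_add]
  smul_mem' := by
    rintro c X ⟨h1, h2, h3⟩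
    refine ⟨fun V W h j ξ => ?_, fun V a ξ => ?_, fun V a j ξ ζ => ?_⟩
    · simp [h1 V W h]
    · exact Submodule.smul_mem _ _ (h2 V a ξ)
    · simp [h3]

/-- restriction of families of functionals to a smaller open set -/
def resPreForm {U V : Opens M} (h : V ≤ U) : A.PreForm U →ₗ[ℝ] A.PreForm V where
  toFun θ := PreForm.of A fun W => θ ⟨W.1, le_trans W.2 h⟩
  map_add' _ _ := rfl
  map_smul' _ _ := rfl

theorem resPreForm_mem {U V : Opens M} (h : V ≤ U) (p : ℤ) : ∀ θ ∈ A.forms U p,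
    A.resPreForm h θ ∈ A.forms V p := by
  rintro X ⟨h1, h2, h3⟩
  exact ⟨fun W W' hW ξ => h1 ⟨W.1, le_trans W.2 h⟩ ⟨W'.1, le_trans W'.2 h⟩ hW ξ,
    fun W => h2 ⟨W.1, le_trans W.2 h⟩,
    fun W => h3 ⟨W.1, le_trans W.2 h⟩⟩

/-- restriction of forms to a smaller open set -/
def resForm {U V : Opens M} (h : V ≤ U) (p : ℤ) : A.forms U p →ₗ[ℝ] A.forms V p :=
  (A.resPreForm h).restrict (A.resPreForm_mem h p)

variable {A} in
theorem form_congr {U : Opens M} (θ : A.PreForm U) (V : Set.Iic U) {i j : ℤ} (h : i = j)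
    {X : A.vf V.1 i} {Y : A.vf V.1 j} (hXY : X.1 = Y.1) : θ V i X = θ V j Y := by
  subst h
  rw [Subtype.ext hXY]

variable {A} in
theorem form_add {U : Opens M} (θ : A.PreForm U) (V : Set.Iic U) {i j k : ℤ} (hi : i = k)
    (hj : j = k) (c : ℝ) {X : A.vf V.1 i} {Y : A.vf V.1 j} {Z : A.vf V.1 k}
    (h : Z.1 = X.1 + c • Y.1) : θ V k Z = θ V i X + c • θ V j Y := by
  subst hi hj
  rw [← map_smul, ← map_add]
  congr 1
  exact Subtype.ext h

/-- The left multiplication of forms by functions: `i_X (ξ θ) = (-1)^{|ξ|(|X| - 1)} ξ i_X θ`,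
the contraction `i_X` having total degree `|X| - 1`. -/
def smulForm (U : Opens M) (a p : ℤ) : A.deg U a →ₗ[ℝ] A.forms U p →ₗ[ℝ] A.forms U (a + p) :=
  LinearMap.mk₂ ℝ
    (fun ξ θ => ⟨PreForm.of A fun V j => sgn (a * (j - 1)) •
        (LinearMap.mulLeft ℝ (A.res (le_base V) ξ.1) ∘ₗ θ.1 V j), by
      obtain ⟨h1, h2, h3⟩ := θ.2
      refine ⟨fun V W h j X => ?_, fun V j X => ?_, fun V b j ζ X => ?_⟩
      · simp [A.res_res, h1 V W h]
      · refine Submodule.smul_mem _ _ ?_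
        rw [add_assoc]
        exact A.mul_mem (A.res_mem _ _ _ ξ.2) (h2 V j X)
      · simp only [PreForm.of_apply, LinearMap.smul_apply, LinearMap.comp_apply,
          LinearMap.mulLeft_apply, h3 V b j ζ X,
          ← mul_assoc]
        rw [A.comm _ a b _ (A.res_mem (le_base V) _ _ ξ.2) ζ.1 ζ.2]
        simp only [smul_mul_assoc, smul_smul, mul_smul_comm, ← sgn_add, mul_assoc]
        congr 1
        apply sgn_congr
        simp only [Int.even_add, Int.even_mul, Int.even_sub, Int.not_even_one]
        tauto⟩)
    (fun ξ ξ' X => by ext V j ζ; simp [add_mul])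
    (fun c ξ X => by ext V j ζ; simp [smul_comm c])
    (fun ξ X X' => by ext V j ζ; simp [mul_add])
    (fun c ξ X => by ext V j ζ; simp [smul_comm c])

theorem smulForm_apply (U : Opens M) (a p : ℤ) (ξ : A.deg U a) (θ : A.forms U p)
    (V : Set.Iic U) (j : ℤ) (X : A.vf V.1 j) : (A.smulForm U a p ξ θ).1 V j X =
      sgn (a * (j - 1)) • (A.res (le_base V) ξ.1 * θ.1 V j X) := rfl

/-- The exterior differential of functions: `i_X (dξ) = X(ξ)`. -/
def d (U : Opens M) (p : ℤ) : A.deg U p →ₗ[ℝ] A.forms U p where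
  toFun ξ := ⟨PreForm.of A fun V j =>
      { toFun := fun X => ap X (A.res (le_base V) ξ.1)
        map_add' := fun _ _ => rfl
        map_smul' := fun _ _ => rfl }, by
    refine ⟨fun V W h j X => ?_, fun V j X => ?_, fun V b j ζ X => ?_⟩
    · change ap _ _ = A.res h (ap X _)
      rw [← A.res_res (le_base V) h, ap_res]
    · rw [add_comm]
      exact ap_mem X (A.res_mem (le_base V) _ _ ξ.2)
    · change A.res _ ζ.1 * ap X _ = ζ.1 * ap X _
      rw [A.res_id]⟩
  map_add' ξ ζ := by ext V j X; simp; rfl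
  map_smul' c ξ := by ext V j X; simp; rfl

/-! ### Homological vector fields and Lie derivatives -/

/-- The graded commutator `[X, Y] = X Y - (-1)^{|X||Y|} Y X` of vector fields. -/
def lie (U : Opens M) (i j : ℤ) : A.vf U i →ₗ[ℝ] A.vf U j →ₗ[ℝ] A.vf U (i + j) :=
  LinearMap.mk₂ ℝ
    (fun X Y => ⟨PreVF.of A fun V => X.1 V * Y.1 V - sgn (i * j) • (Y.1 V * X.1 V), by
      obtain ⟨h1, h2, h3⟩ := X.2
      obtain ⟨k1, k2, k3⟩ := Y.2
      refine ⟨fun V W h ξ => ?_, fun V a ξ hξ => ?_, fun V a ξ hξ ζ => ?_⟩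
      · simp [h1 V W h, k1 V W h]
      · refine sub_mem ?_ (Submodule.smul_mem _ _ ?_)
        · rw [add_assoc]
          exact h2 V _ _ (k2 V a ξ hξ)
        · rw [add_comm i j, add_assoc]
          exact k2 V _ _ (h2 V a ξ hξ)
      · simp only [PreVF.of_apply, LinearMap.sub_apply,
          Module.End.mul_apply, LinearMap.smul_apply, k3 V a ξ hξ, h3 V a ξ hξ, map_add, map_smul,
          h3 V _ _ (k2 V a ξ hξ), k3 V _ _ (h2 V a ξ hξ), smul_add, smul_smul, sub_mul, mul_sub,
          smul_sub, smul_mul_assoc, mul_smul_comm, ← sgn_add]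
        rw [sgn_congr (a := i * j + j * (i + a)) (b := j * a),
          sgn_congr (a := i * (j + a)) (b := i * j + i * a),
          sgn_congr (a := j * a + i * a) (b := (i + j) * a),
          sgn_congr (a := i * j + (i * a + j * a)) (b := (i + j) * a + i * j)]
        · abel
        all_goals
          simp only [Int.even_add, Int.even_mul]
          tauto⟩)
    (fun X X' Y => by ext V ζ; simp [smul_add]; abel)
    (fun c X Y => by ext V ζ; simp [smul_sub, smul_comm c])
    (fun X Y Y' => by ext V ζ; simp [smul_add]; abel)
    (fun c X Y => by ext V ζ; simp [smul_sub, smul_comm c])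

/-- A homological vector field: a vector field of degree `1` on the whole `[n]`-manifold which
squares to zero. -/
structure HomologicalVF where
  /-- the vector field -/
  toVF : A.vf ⊤ 1
  sq : ∀ (V : Set.Iic (⊤ : Opens M)) (ξ : A.sec V.1), toVF.1 V (toVF.1 V ξ) = 0

end NManifold

namespace NManifold.HomologicalVF

variable {n : ℕ} {r : Fin n → ℕ} {M : Type u} [TopologicalSpace M]
  [ChartedSpace (EuclideanSpace ℝ (Fin m)) M] {A : NManifold.{u, v} (m := m) r M}
  (Q : A.HomologicalVF)

/-- the restriction of `Q` to an open set -/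
def on (U : Opens M) : A.vf U 1 := A.resVF le_top 1 Q.toVF

theorem on_on (U : Opens M) (ξ : A.sec U) : ap (Q.on U) (ap (Q.on U) ξ) = 0 :=
  Q.sq ⟨U, le_top (a := U)⟩ ξ

/-- `ξ ↦ Q(ξ)` on functions of degree `a` -/
def act (U : Opens M) (a : ℤ) : A.deg U a →ₗ[ℝ] A.deg U (a + 1) :=
  (ap (Q.on U)).restrict fun ξ hξ => by
    rw [add_comm]
    exact ap_mem (Q.on U) hξ

/-- The Lie derivative `L_Q X = [Q, X]` of vector fields. -/
def lieVF (U : Opens M) (j : ℤ) : A.vf U j →ₗ[ℝ] A.vf U (j + 1) where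
  toFun X := ⟨(A.lie U 1 j (Q.on U) X).1, by
    rw [add_comm]
    exact (A.lie U 1 j (Q.on U) X).2⟩
  map_add' X Y := by ext1; simp
  map_smul' c X := by ext1; simp

theorem lieVF_apply (U : Opens M) (j : ℤ) (X : A.vf U j) (V : Set.Iic U) (ξ : A.sec V.1) :
    (Q.lieVF U j X).1 V ξ =
      ap (Q.on V.1) (X.1 V ξ) - sgn j • X.1 V (ap (Q.on V.1) ξ) := by
  have h : (Q.lieVF U j X).1 V ξ =
      ap (Q.on V.1) (X.1 V ξ) - sgn (1 * j) • X.1 V (ap (Q.on V.1) ξ) := rfl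
  rw [h, one_mul]

theorem lieVF_res {U V : Opens M} (h : V ≤ U) (j : ℤ) (X : A.vf U j) :
    Q.lieVF V j (A.resVF h j X) = A.resVF h (j + 1) (Q.lieVF U j X) := by
  ext W ξ
  rfl

theorem lieVF_lieVF (U : Opens M) (j : ℤ) (X : A.vf U j) :
    (Q.lieVF U (j + 1) (Q.lieVF U j X)).1 = 0 := by
  ext V ξ
  simp only [lieVF_apply, map_sub, map_smul, on_on, smul_zero, sub_zero, zero_sub, map_zero]
  rw [← neg_sgn]
  simp

theorem lieVF_smul (U : Opens M) (a j : ℤ) (ξ : A.deg U a) (X : A.vf U j) :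
    (Q.lieVF U (a + j) (A.smulVF U a j ξ X)).1 =
      (A.smulVF U (a + 1) j (Q.act U a ξ) X).1 +
        sgn a • (A.smulVF U a (j + 1) ξ (Q.lieVF U j X)).1 := by
  ext V ζ
  change (Q.lieVF U (a + j) (A.smulVF U a j ξ X)).1 V ζ =
    A.res (le_base V) (ap (Q.on U) ξ.1) * X.1 V ζ +
      sgn a • (A.res (le_base V) ξ.1 * (Q.lieVF U j X).1 V ζ)
  rw [lieVF_apply, lieVF_apply]
  change ap (Q.on V.1) (A.res (le_base V) ξ.1 * X.1 V ζ) -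
    sgn (a + j) • (A.res (le_base V) ξ.1 * X.1 V (ap (Q.on V.1) ζ)) = _
  rw [ap_mul _ (A.res_mem _ _ _ ξ.2), ← ap_res (le_base V), one_mul,
    mul_sub, smul_sub, mul_smul_comm, smul_smul, ← sgn_add, ← add_sub_assoc]
  rfl

/-- the formula for the Lie derivative of one-forms, see `lieForm` -/
def preLieForm (U : Opens M) : A.PreForm U →ₗ[ℝ] A.PreForm U where
  toFun θ := PreForm.of A fun V j => sgn (j - 1) • (ap (Q.on V.1) ∘ₗ θ V j - θ V (j + 1) ∘ₗ Q.lieVF V.1 j)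
  map_add' θ θ' := by
    refine PreForm.ext fun V => funext fun j => LinearMap.ext fun X => ?_
    simp only [PreForm.of_apply, PreForm.add_apply, Pi.add_apply, LinearMap.smul_apply, LinearMap.sub_apply, LinearMap.comp_apply,
      LinearMap.add_apply, map_add, smul_sub, smul_add]
    abel
  map_smul' c θ := by
    refine PreForm.ext fun V => funext fun j => LinearMap.ext fun X => ?_
    simp only [PreForm.of_apply, PreForm.smul_apply, Pi.smul_apply, LinearMap.smul_apply, LinearMap.sub_apply, LinearMap.comp_apply,
      map_smul, smul_sub, RingHom.id_apply, smul_comm c]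

theorem preLieForm_apply (U : Opens M) (θ : A.PreForm U) (V : Set.Iic U) (j : ℤ)
    (X : A.vf V.1 j) : Q.preLieForm U θ V j X =
      sgn (j - 1) • (ap (Q.on V.1) (θ V j X) - θ V (j + 1) (Q.lieVF V.1 j X)) := rfl

theorem form_lieVF_smul {U : Opens M} {p : ℤ} (θ : A.forms U p) (V : Set.Iic U) (b j : ℤ)
    (ζ : A.deg V.1 b) (X : A.vf V.1 j) :
    θ.1 V (b + j + 1) (Q.lieVF V.1 (b + j) (A.smulVF V.1 b j ζ X)) =
      ap (Q.on V.1) ζ.1 * θ.1 V j X + sgn b • (ζ.1 * θ.1 V (j + 1) (Q.lieVF V.1 j X)) := by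
  rw [← θ.2.2.2 V b (j + 1) ζ (Q.lieVF V.1 j X)]
  have e : _ = ap (Q.on V.1) ζ.1 * θ.1 V j X := θ.2.2.2 V (b + 1) j (Q.act V.1 b ζ) X
  rw [← e]
  exact form_add θ.1 V (by ring) (by ring) _ (Q.lieVF_smul V.1 b j ζ X)

theorem preLieForm_mem (U : Opens M) (p : ℤ) : ∀ θ ∈ A.forms U p,
    Q.preLieForm U θ ∈ A.forms U (p + 1) := by
  intro θ hθ
  obtain ⟨h1, h2, h3⟩ := id hθ
  refine ⟨fun V W h j X => ?_, fun V j X => ?_, fun V b j ζ X => ?_⟩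
  · rw [preLieForm_apply, preLieForm_apply, map_smul, map_sub, lieVF_res, h1 V W h, h1 V W h,
      ← ap_res h]
    rfl
  · rw [preLieForm_apply]
    refine Submodule.smul_mem _ _ (sub_mem ?_ ?_)
    · rw [add_comm p 1, add_assoc]
      exact ap_mem _ (h2 V j X)
    · rw [add_assoc, add_comm 1 j]
      exact h2 V _ _
  · rw [preLieForm_apply, preLieForm_apply, Q.form_lieVF_smul ⟨θ, hθ⟩, h3 V b j ζ X,
      ap_mul _ ζ.2, one_mul, add_sub_add_left_eq_sub, ← smul_sub, ← mul_sub, smul_smul,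
      mul_smul_comm, ← sgn_add]
    congr 1
    apply sgn_congr
    simp only [Int.even_add, Int.even_sub, Int.not_even_one]
    tauto

/-- The Lie derivative of one-forms, determined by Cartan's formula
`i_{[Q, X]} = L_Q i_X - (-1)^{|X| - 1} i_X L_Q`, where `L_Q` has total degree `1`
and `i_X` has total degree `|X| - 1`. -/
def lieForm (U : Opens M) (p : ℤ) : A.forms U p →ₗ[ℝ] A.forms U (p + 1) :=
  (Q.preLieForm U).restrict (Q.preLieForm_mem U p)

theorem lieForm_apply (U : Opens M) (p : ℤ) (θ : A.forms U p) (V : Set.Iic U) (j : ℤ)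
    (X : A.vf V.1 j) : (Q.lieForm U p θ).1 V j X =
      sgn (j - 1) • (ap (Q.on V.1) (θ.1 V j X) - θ.1 V (j + 1) (Q.lieVF V.1 j X)) := rfl

/-- `L_Q` anticommutes with the exterior differential. -/
theorem lieForm_d (U : Opens M) (a : ℤ) (ξ : A.deg U a) :
    Q.lieForm U a (A.d U a ξ) = -A.d U (a + 1) (Q.act U a ξ) := by
  ext V j X
  rw [lieForm_apply]
  change sgn (j - 1) • (ap (Q.on V.1) (ap X _) -
    (Q.lieVF V.1 j X).1 ⟨V.1, le_refl V.1⟩ (A.res (le_base V) ξ.1)) =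
      -(ap X (A.res (le_base V) (ap (Q.on U) ξ.1)))
  rw [lieVF_apply, ← ap_res (le_base V)]
  change sgn (j - 1) • (ap (Q.on V.1) (ap X _) -
    (ap (Q.on V.1) (ap X _) - sgn j • ap X _)) = 
      -(ap X (ap (Q.on V.1) _))
  rw [sub_sub_cancel, smul_smul, ← sgn_add, ← neg_one_smul ℝ, ← sgn_even (a := 0) (by simp),
    neg_sgn, sgn_congr (a := j - 1 + j) (b := 0 + 1)]
  simp only [Int.even_add, Int.even_sub, Int.not_even_one]
  tauto

theorem lieForm_lieForm (U : Opens M) (p : ℤ) (θ : A.forms U p) :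
    (Q.lieForm U (p + 1) (Q.lieForm U p θ)).1 = 0 := by
  ext V j X
  have h : Q.lieVF V.1 (j + 1) (Q.lieVF V.1 j X) = 0 := Subtype.ext (Q.lieVF_lieVF V.1 j X)
  simp only [lieForm_apply, map_sub, map_smul, on_on, h, map_zero, sub_zero, smul_sub]
  rw [show j + 1 - 1 = j - 1 + 1 by ring, ← neg_sgn]
  simp

theorem lieForm_smul_aux {R : Type*} [Ring R] [Algebra ℝ R] (a j : ℤ) (q f x y z : R) :
    sgn (j - 1) • (sgn (a * (j - 1)) • (q * x + sgn (1 * a) • (f * y)) -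
        sgn (a * (j + 1 - 1)) • (f * z)) =
      sgn ((a + 1) * (j - 1)) • (q * x) +
        sgn a • sgn (a * (j - 1)) • (f * sgn (j - 1) • (y - z)) := by
  simp only [smul_add, smul_sub, smul_smul, mul_smul_comm, mul_sub, ← sgn_add]
  rw [sgn_congr (a := j - 1 + (a * j - a * 1)) (b := (a + 1) * j - (a + 1) * 1),
    sgn_congr (a := j - 1 + (a * j - a * 1 + 1 * a)) (b := a + (a * j - a * 1 + (j - 1))),
    sgn_congr (a := j - 1 + (a * (j + 1) - a * 1)) (b := a + (a * j - a * 1 + (j - 1))),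
    add_sub_assoc]
  all_goals
    simp only [Int.even_add, Int.even_sub, Int.even_mul, Int.not_even_one]
    tauto

theorem lieForm_smul (U : Opens M) (a p : ℤ) (ξ : A.deg U a) (θ : A.forms U p) :
    (Q.lieForm U (a + p) (A.smulForm U a p ξ θ)).1 =
      (A.smulForm U (a + 1) p (Q.act U a ξ) θ).1 +
        sgn a • (A.smulForm U a (p + 1) ξ (Q.lieForm U p θ)).1 := by
  ext V j X
  have hQ : A.res (le_base V) (Q.act U a ξ).1 = ap (Q.on V.1) (A.res (le_base V) ξ.1) :=
    (ap_res (le_base V) (Q.on U) ξ.1).symm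
  have s1 : ap (Q.on V.1) ((A.smulForm U a p ξ θ).1 V j X) = _ :=
    (congrArg (ap (Q.on V.1)) (A.smulForm_apply U a p ξ θ V j X)).trans
      ((map_smul _ _ _).trans (congrArg (sgn (a * (j - 1)) • ·)
        (ap_mul (Q.on V.1) (A.res_mem (le_base V) a ξ.1 ξ.2) (θ.1 V j X))))
  have s2 := A.smulForm_apply U a p ξ θ V (j + 1) (Q.lieVF V.1 j X)
  have s3 := (A.smulForm_apply U (a + 1) p (Q.act U a ξ) θ V j X).trans
    (congrArg (fun q => sgn ((a + 1) * (j - 1)) • (q * θ.1 V j X)) hQ)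
  have s4 := (A.smulForm_apply U a (p + 1) ξ (Q.lieForm U p θ) V j X).trans
    (congrArg (fun q => sgn (a * (j - 1)) • (A.res (le_base V) ξ.1 * q))
      (Q.lieForm_apply U p θ V j X))
  exact (Q.lieForm_apply U (a + p) (A.smulForm U a p ξ θ) V j X).trans
    ((congrArg₂ (fun u v => sgn (j - 1) • (u - v)) s1 s2).trans
    ((lieForm_smul_aux a j _ _ _ _ _).trans
      (congrArg₂ (fun u v => u + sgn a • v) s3 s4).symm))

end NManifold.HomologicalVF

/-! ### Poisson brackets -/

namespace NManifold

variable {n : ℕ} {r : Fin n → ℕ} {M : Type u} [TopologicalSpace M]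
  [ChartedSpace (EuclideanSpace ℝ (Fin m)) M] (A : NManifold.{u, v} (m := m) r M)

/-- the linear map on functions with given restrictions to homogeneous functions -/
def ofPieces (U : Opens M) {N : Type*} [AddCommGroup N] [Module ℝ N]
    (f : ∀ a, A.deg U a →ₗ[ℝ] N) : A.sec U →ₗ[ℝ] N :=
  DirectSum.toModule ℝ ℤ N f ∘ₗ (DirectSum.decomposeLinearEquiv (A.deg U)).toLinearMap

theorem ofPieces_apply (U : Opens M) {N : Type*} [AddCommGroup N] [Module ℝ N]
    (f : ∀ a, A.deg U a →ₗ[ℝ] N) (a : ℤ) (ξ : A.deg U a) : A.ofPieces U f ξ.1 = f a ξ := by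
  simp [ofPieces]

/-- A degree `k` Poisson bracket on an `[n]`-manifold. -/
structure PoissonBracket (k : ℤ) where
  /-- the bracket of functions over an open set -/
  bracket : ∀ U, A.sec U →ₗ[ℝ] A.sec U →ₗ[ℝ] A.sec U
  bracket_res : ∀ {U V : Opens M} (h : V ≤ U) (ξ ζ : A.sec U),
    bracket V (A.res h ξ) (A.res h ζ) = A.res h (bracket U ξ ζ)
  bracket_mem : ∀ U a b, ∀ ξ ∈ A.deg U a, ∀ ζ ∈ A.deg U b,
    bracket U ξ ζ ∈ A.deg U (a + b + k)
  skew : ∀ U a b, ∀ ξ ∈ A.deg U a, ∀ ζ ∈ A.deg U b,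
    bracket U ξ ζ = -(sgn ((a + k) * (b + k)) • bracket U ζ ξ)
  leibniz : ∀ U a b c, ∀ ξ ∈ A.deg U a, ∀ ζ ∈ A.deg U b, ∀ η ∈ A.deg U c,
    bracket U ξ (ζ * η) = bracket U ξ ζ * η + sgn ((a + k) * b) • (ζ * bracket U ξ η)
  jacobi : ∀ U a b c, ∀ ξ ∈ A.deg U a, ∀ ζ ∈ A.deg U b, ∀ η ∈ A.deg U c,
    bracket U ξ (bracket U ζ η) = bracket U (bracket U ξ ζ) η +
      sgn ((a + k) * (b + k)) • bracket U ζ (bracket U ξ η)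

namespace PoissonBracket

variable {A} {k : ℤ} (P : A.PoissonBracket k)

theorem leibniz' (U : Opens M) (a b : ℤ) (ξ : A.sec U) (hξ : ξ ∈ A.deg U a) (ζ : A.sec U)
    (hζ : ζ ∈ A.deg U b) (η : A.sec U) :
    P.bracket U ξ (ζ * η) = P.bracket U ξ ζ * η + sgn ((a + k) * b) • (ζ * P.bracket U ξ η) := by
  have h : P.bracket U ξ ∘ₗ LinearMap.mulLeft ℝ ζ = LinearMap.mulLeft ℝ (P.bracket U ξ ζ) +
      sgn ((a + k) * b) • (LinearMap.mulLeft ℝ ζ ∘ₗ P.bracket U ξ) :=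
    A.hom_ext fun c η hη => P.leibniz U a b c ξ hξ ζ hζ η hη
  exact LinearMap.congr_fun h η

/-- The Hamiltonian vector field `{ξ, ·}` of a function `ξ`. -/
def ham (U : Opens M) (a : ℤ) : A.deg U a →ₗ[ℝ] A.vf U (a + k) where
  toFun ξ := ⟨PreVF.of A fun V => P.bracket V.1 (A.res (le_base V) ξ.1), by
    refine ⟨fun V W h ζ => ?_, fun V b ζ hζ => ?_, fun V b ζ hζ η => ?_⟩
    · exact (congrArg (fun x => P.bracket W.1 x (A.res h ζ))
        (A.res_res (le_base V) h ξ.1).symm).trans (P.bracket_res h _ ζ)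
    · rw [add_right_comm]
      exact P.bracket_mem _ _ _ _ (A.res_mem _ _ _ ξ.2) ζ hζ
    · exact P.leibniz' _ _ _ _ (A.res_mem _ _ _ ξ.2) ζ hζ η⟩
  map_add' ξ ζ := by ext V η; simp
  map_smul' c ξ := by ext V η; simp

theorem ham_apply (U : Opens M) (a : ℤ) (ξ : A.deg U a) (V : Set.Iic U) (ζ : A.sec V.1) :
    (P.ham U a ξ).1 V ζ = P.bracket V.1 (A.res (le_base V) ξ.1) ζ := rfl

theorem ham_res {U V : Opens M} (h : V ≤ U) (a : ℤ) (ξ : A.deg U a) :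
    P.ham V a (A.resDeg h a ξ) = A.resVF h (a + k) (P.ham U a ξ) := by
  refine Subtype.ext (funext fun W => ?_)
  exact congrArg (P.bracket W.1) (A.res_res h (le_base W) ξ.1)

/-- `{ξζ, ·} = ξ {ζ, ·} + (-1)^{|ξ||ζ|} ζ {ξ, ·}` -/
theorem ham_mul (U : Opens M) (a b : ℤ) (ξ : A.deg U a) (ζ : A.deg U b) :
    (P.ham U (a + b) (A.mul ξ ζ)).1 = (A.smulVF U a (b + k) ξ (P.ham U b ζ)).1 +
      sgn (a * b) • (A.smulVF U b (a + k) ζ (P.ham U a ξ)).1 := by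
  refine funext fun V => A.hom_ext fun c η hη => ?_
  change P.bracket V.1 (A.res (le_base V) (ξ.1 * ζ.1)) η =
    A.res (le_base V) ξ.1 * P.bracket V.1 (A.res (le_base V) ζ.1) η +
      sgn (a * b) • (A.res (le_base V) ζ.1 * P.bracket V.1 (A.res (le_base V) ξ.1) η)
  have hx := A.res_mem (le_base V) a ξ.1 ξ.2
  have hz := A.res_mem (le_base V) b ζ.1 ζ.2
  rw [map_mul]
  generalize A.res (le_base V) ξ.1 = x at hx ⊢
  generalize A.res (le_base V) ζ.1 = z at hz ⊢
  rw [P.skew _ _ _ _ (A.mul_mem hx hz) _ hη, P.leibniz' _ _ _ _ hη _ hx,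
    P.skew _ _ _ _ hη _ hx, P.skew _ _ _ _ hη _ hz, neg_mul, smul_mul_assoc,
    A.comm _ _ _ _ (P.bracket_mem _ _ _ _ hx _ hη) _ hz]
  simp only [smul_add, smul_neg, smul_smul, mul_neg, mul_smul_comm, neg_add, neg_neg, ← sgn_add]
  rw [add_comm]
  congr 2
  · rw [sgn_even, one_smul]
    simp only [Int.even_add, Int.even_mul]
    by_cases Even a <;> by_cases Even b <;> by_cases Even c <;> by_cases Even k <;> simp [*]
  · apply sgn_congr
    simp only [Int.even_add, Int.even_mul]
    by_cases Even a <;> by_cases Even b <;> by_cases Even c <;> by_cases Even k <;> simp [*]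

/-- the components of `preSharp` -/
def sharpPiece (U : Opens M) (p : ℤ) (θ : A.PreForm U) (V : Set.Iic U) (a : ℤ) :
    A.deg V.1 a →ₗ[ℝ] A.sec V.1 :=
  -sgn ((a + k) * (p + k)) • (θ V (a + k) ∘ₗ P.ham V.1 a)

theorem sharpPiece_apply (U : Opens M) (p : ℤ) (θ : A.PreForm U) (V : Set.Iic U) (a : ℤ)
    (ξ : A.deg V.1 a) : P.sharpPiece U p θ V a ξ =
      -sgn ((a + k) * (p + k)) • θ V (a + k) (P.ham V.1 a ξ) := rfl

/-- The underlying linear maps of the vector field `♯θ`, see `sharp`. -/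
def preSharp (U : Opens M) (p : ℤ) : A.PreForm U →ₗ[ℝ] A.PreVF U where
  toFun θ := PreVF.of A fun V => A.ofPieces V.1 (P.sharpPiece U p θ V)
  map_add' θ θ' := by
    refine funext fun V => A.hom_ext fun a ξ hξ => ?_
    refine (A.ofPieces_apply _ _ _ ⟨ξ, hξ⟩).trans (Eq.trans ?_ (congrArg₂ (· + ·)
      (A.ofPieces_apply _ (P.sharpPiece U p θ V) _ ⟨ξ, hξ⟩)
      (A.ofPieces_apply _ (P.sharpPiece U p θ' V) _ ⟨ξ, hξ⟩)).symm)
    exact smul_add _ _ _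
  map_smul' c θ := by
    refine funext fun V => A.hom_ext fun a ξ hξ => ?_
    refine (A.ofPieces_apply _ _ _ ⟨ξ, hξ⟩).trans (Eq.trans ?_ (congrArg (c • ·)
      (A.ofPieces_apply _ (P.sharpPiece U p θ V) _ ⟨ξ, hξ⟩)).symm)
    exact smul_comm _ _ _

theorem preSharp_apply (U : Opens M) (p : ℤ) (θ : A.PreForm U) (V : Set.Iic U) (a : ℤ)
    (ξ : A.deg V.1 a) : P.preSharp U p θ V ξ.1 =
      -sgn ((a + k) * (p + k)) • θ V (a + k) (P.ham V.1 a ξ) :=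
  A.ofPieces_apply V.1 (P.sharpPiece U p θ V) a ξ

theorem form_ham_mul {U : Opens M} {p : ℤ} (θ : A.forms U p) (V : Set.Iic U) (a b : ℤ)
    (ξ : A.deg V.1 a) (ζ : A.deg V.1 b) :
    θ.1 V (a + b + k) (P.ham V.1 (a + b) (A.mul ξ ζ)) =
      ξ.1 * θ.1 V (b + k) (P.ham V.1 b ζ) +
        sgn (a * b) • (ζ.1 * θ.1 V (a + k) (P.ham V.1 a ξ)) := by
  rw [← θ.2.2.2 V a (b + k) ξ (P.ham V.1 b ζ), ← θ.2.2.2 V b (a + k) ζ (P.ham V.1 a ξ)]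
  exact form_add θ.1 V (by ring) (by ring) _ (P.ham_mul V.1 a b ξ ζ)

theorem preSharp_mem (U : Opens M) (p : ℤ) : ∀ θ ∈ A.forms U p,
    P.preSharp U p θ ∈ A.vf U (p + k) := by
  intro θ hθ
  obtain ⟨h1, h2, h3⟩ := id hθ
  refine ⟨fun V W h ξ => ?_, fun V a ξ hξ => ?_, fun V a ξ hξ ζ => ?_⟩
  · have e : P.preSharp U p θ W ∘ₗ (A.res h).toLinearMap =
        (A.res h).toLinearMap ∘ₗ P.preSharp U p θ V := by
      refine A.hom_ext fun a ξ hξ => ?_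
      have e1 := P.preSharp_apply U p θ V a ⟨ξ, hξ⟩
      have e2 := P.preSharp_apply U p θ W a (A.resDeg h a ⟨ξ, hξ⟩)
      refine e2.trans (Eq.trans ?_ (congrArg (A.res h) e1).symm)
      rw [map_smul, ham_res, h1 V W h]
    exact LinearMap.congr_fun e ξ
  · have e1 := P.preSharp_apply U p θ V a ⟨ξ, hξ⟩
    change P.preSharp U p θ V ξ = _ at e1
    rw [e1]
    refine Submodule.smul_mem _ _ ?_
    rw [show p + k + a = p + (a + k) by ring]
    exact h2 V _ _
  · have e : P.preSharp U p θ V ∘ₗ LinearMap.mulLeft ℝ ξ =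
        LinearMap.mulLeft ℝ (P.preSharp U p θ V ξ) +
          sgn ((p + k) * a) • (LinearMap.mulLeft ℝ ξ ∘ₗ P.preSharp U p θ V) := by
      refine A.hom_ext fun b ζ hζ => ?_
      have e1 := P.preSharp_apply U p θ V a ⟨ξ, hξ⟩
      have e2 := P.preSharp_apply U p θ V b ⟨ζ, hζ⟩
      have e3 := P.preSharp_apply U p θ V (a + b) (A.mul ⟨ξ, hξ⟩ ⟨ζ, hζ⟩)
      rw [P.form_ham_mul ⟨θ, hθ⟩ V a b ⟨ξ, hξ⟩ ⟨ζ, hζ⟩] at e3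
      change P.preSharp U p θ V ξ = _ at e1
      change P.preSharp U p θ V ζ = _ at e2
      change P.preSharp U p θ V (ξ * ζ) = _ at e3
      change P.preSharp U p θ V (ξ * ζ) = P.preSharp U p θ V ξ * ζ +
          sgn ((p + k) * a) • (ξ * P.preSharp U p θ V ζ)
      have hm := h2 V (a + k) (P.ham V.1 a ⟨ξ, hξ⟩)
      rw [e1, e2, e3]
      generalize θ V (a + k) (P.ham V.1 a ⟨ξ, hξ⟩) = x at hm ⊢
      change _ • (ξ * θ V (b + k) (P.ham V.1 b ⟨ζ, hζ⟩) + _ • (ζ * x)) = _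
      generalize θ V (b + k) (P.ham V.1 b ⟨ζ, hζ⟩) = y
      rw [A.comm _ _ _ _ hζ _ hm]
      simp only [neg_smul, neg_mul, mul_neg, smul_neg, smul_add, smul_smul, smul_mul_assoc,
        mul_smul_comm, ← sgn_add]
      rw [add_comm]
      congr 3
      all_goals
        apply sgn_congr
        simp only [Int.even_add, Int.even_mul]
        by_cases Even a <;> by_cases Even b <;> by_cases Even p <;> by_cases Even k <;> simp [*]
    exact LinearMap.congr_fun e ζ

/-- The map `♯` from one-forms to vector fields induced by a degree `k` Poisson bracket:
`(♯θ)(ξ) = -(-1)^{(|ξ| + k)(|θ| + k)} θ({ξ, ·})`. It is the odd linear map with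
`♯(dξ) = {ξ, ·}`, see `sharp_d` and `sharp_smul`. -/
def sharp (U : Opens M) (p : ℤ) : A.forms U p →ₗ[ℝ] A.vf U (p + k) :=
  (P.preSharp U p).restrict (P.preSharp_mem U p)

theorem sharp_apply (U : Opens M) (p : ℤ) (θ : A.forms U p) (V : Set.Iic U) (a : ℤ)
    (ξ : A.deg V.1 a) : (P.sharp U p θ).1 V ξ.1 =
      -sgn ((a + k) * (p + k)) • θ.1 V (a + k) (P.ham V.1 a ξ) :=
  P.preSharp_apply U p θ.1 V a ξ

theorem sharp_res {U V : Opens M} (h : V ≤ U) (p : ℤ) (θ : A.forms U p) :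
    P.sharp V p (A.resForm h p θ) = A.resVF h (p + k) (P.sharp U p θ) := by
  refine Subtype.ext (funext fun W => A.hom_ext fun a ξ hξ => ?_)
  exact (P.sharp_apply V p (A.resForm h p θ) W a ⟨ξ, hξ⟩).trans
    (P.sharp_apply U p θ ⟨W.1, le_trans W.2 h⟩ a ⟨ξ, hξ⟩).symm

/-- `♯(dξ) = {ξ, ·}` -/
theorem sharp_d (U : Opens M) (a : ℤ) (ξ : A.deg U a) :
    P.sharp U a (A.d U a ξ) = P.ham U a ξ := by
  refine Subtype.ext (funext fun V => A.hom_ext fun b ζ hζ => ?_)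
  refine (P.sharp_apply U a (A.d U a ξ) V b ⟨ζ, hζ⟩).trans ?_
  change -sgn _ • P.bracket V.1 (A.res le_rfl ζ) (A.res (le_base V) ξ.1) = P.bracket V.1 _ ζ
  rw [A.res_id, P.skew _ a b _ (A.res_mem _ _ _ ξ.2) _ hζ, mul_comm (a + k), neg_smul]

theorem sharp_smul_aux {R : Type*} [Ring R] [Algebra ℝ R] (a b p k : ℤ) (f x : R) :
    -sgn ((b + k) * (a + p + k)) • sgn (a * (b + k - 1)) • (f * x) =
      sgn a • (f * (-sgn ((b + k) * (p + k)) • x)) := by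
  simp only [neg_smul, smul_neg, mul_neg, neg_mul, smul_smul, mul_smul_comm, ← sgn_add]
  congr 2
  apply sgn_congr
  simp only [Int.even_add, Int.even_mul, Int.even_sub, Int.not_even_one]
  by_cases Even a <;> by_cases Even b <;> by_cases Even p <;> by_cases Even k <;> simp [*]

/-- `♯(ξθ) = (-1)^{|ξ|} ξ ♯(θ)` -/
theorem sharp_smul (U : Opens M) (a p : ℤ) (ξ : A.deg U a) (θ : A.forms U p) :
    (P.sharp U (a + p) (A.smulForm U a p ξ θ)).1 =
      sgn a • (A.smulVF U a (p + k) ξ (P.sharp U p θ)).1 := by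
  refine funext fun V => A.hom_ext fun b ζ hζ => ?_
  exact (P.sharp_apply U (a + p) (A.smulForm U a p ξ θ) V b ⟨ζ, hζ⟩).trans
    ((congrArg (-sgn ((b + k) * (a + p + k)) • ·)
      (A.smulForm_apply U a p ξ θ V (b + k) (P.ham V.1 b ⟨ζ, hζ⟩))).trans
    ((sharp_smul_aux a b p k _ _).trans
      (congrArg (fun x => sgn a • (A.res (le_base V) ξ.1 * x))
        (P.sharp_apply U p θ V b ⟨ζ, hζ⟩).symm)))

end PoissonBracket

end NManifold

/-! ### Differential graded modules -/

universe w

/-- A presheaf of graded real vector spaces on `M`. Its component of degree `p` over `U` is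
`deg U p`; the spaces `amb U` only serve to contain these components. -/
structure GradedPresheaf (M : Type u) [TopologicalSpace M] where
  /-- a vector space which contains all homogeneous components -/
  amb : Opens M → Type w
  [addCommGroup : ∀ U, AddCommGroup (amb U)]
  [module : ∀ U, Module ℝ (amb U)]
  /-- the homogeneous components -/
  deg : ∀ U, ℤ → Submodule ℝ (amb U)
  /-- restriction to a smaller open set -/
  res : ∀ {U V : Opens M}, V ≤ U → (amb U →ₗ[ℝ] amb V)
  res_mem : ∀ {U V : Opens M} (h : V ≤ U) (p : ℤ), ∀ η ∈ deg U p, res h η ∈ deg V p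
  res_id : ∀ (U : Opens M) (η : amb U), res le_rfl η = η
  res_res : ∀ {U V W : Opens M} (h : V ≤ U) (h' : W ≤ V) (η : amb U),
    res h' (res h η) = res (h'.trans h) η

attribute [instance] GradedPresheaf.addCommGroup GradedPresheaf.module

namespace GradedPresheaf

variable {M : Type u} [TopologicalSpace M]

/-- restriction of homogeneous elements -/
def resDeg (E : GradedPresheaf.{u, w} M) {U V : Opens M} (h : V ≤ U) (p : ℤ) :
    E.deg U p →ₗ[ℝ] E.deg V p :=
  (E.res h).restrict (E.res_mem h p)

/-- transport along an equality of degrees -/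
def cast (E : GradedPresheaf.{u, w} M) (U : Opens M) {p q : ℤ} (h : p = q) :
    E.deg U p →ₗ[ℝ] E.deg U q :=
  Submodule.inclusion (h ▸ le_rfl)

/-- The shift `E[k]`, with `E[k]^p = E^{p + k}`. -/
def shift (E : GradedPresheaf.{u, w} M) (k : ℤ) : GradedPresheaf.{u, w} M where
  amb := E.amb
  deg U p := E.deg U (p + k)
  res h := E.res h
  res_mem h p := E.res_mem h (p + k)
  res_id := E.res_id
  res_res := E.res_res

/-- Degree preserving linear maps which commute with restrictions. -/
structure Hom (E F : GradedPresheaf.{u, w} M) where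
  /-- the map on elements of degree `p` over `U` -/
  toFun : ∀ U p, E.deg U p →ₗ[ℝ] F.deg U p
  naturality : ∀ {U V : Opens M} (h : V ≤ U) (p : ℤ) (η : E.deg U p),
    toFun V p (E.resDeg h p η) = F.resDeg h p (toFun U p η)

end GradedPresheaf

section Modules

variable {n : ℕ} {r : Fin n → ℕ} {M : Type u} [TopologicalSpace M]
  [ChartedSpace (EuclideanSpace ℝ (Fin m)) M] {A : NManifold.{u, v} (m := m) r M}

/-- A left differential graded module over a Lie `n`-algebroid `(A, Q)`, as a presheaf. The gluing
of sections and local freeness, which do not enter the notion of a morphism, are not recorded. -/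
structure LeftDGModule (Q : A.HomologicalVF) extends GradedPresheaf.{u, w} M where
  /-- the multiplication `ξ η` of elements by functions -/
  smul : ∀ U a p, A.deg U a →ₗ[ℝ] deg U p →ₗ[ℝ] deg U (a + p)
  /-- the differential -/
  D : ∀ U p, deg U p →ₗ[ℝ] deg U (p + 1)
  one_smul : ∀ U p (η : deg U p), (smul U 0 p (A.one U) η).1 = η.1
  mul_smul : ∀ U a b p (ξ : A.deg U a) (ζ : A.deg U b) (η : deg U p),
    (smul U (a + b) p (A.mul ξ ζ) η).1 = (smul U a (b + p) ξ (smul U b p ζ η)).1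
  smul_res : ∀ {U V : Opens M} (h : V ≤ U) (a p : ℤ) (ξ : A.deg U a) (η : deg U p),
    (smul V a p (A.resDeg h a ξ) (toGradedPresheaf.resDeg h p η)).1 = res h (smul U a p ξ η).1
  D_res : ∀ {U V : Opens M} (h : V ≤ U) (p : ℤ) (η : deg U p),
    (D V p (toGradedPresheaf.resDeg h p η)).1 = res h (D U p η).1
  D_D : ∀ U p (η : deg U p), (D U (p + 1) (D U p η)).1 = 0
  leibniz : ∀ U a p (ξ : A.deg U a) (η : deg U p),
    (D U (a + p) (smul U a p ξ η)).1 =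
      (smul U (a + 1) p (Q.act U a ξ) η).1 + sgn a • (smul U a (p + 1) ξ (D U p η)).1

/-- A right differential graded module over a Lie `n`-algebroid `(A, Q)`, as a presheaf. The gluing
of sections and local freeness, which do not enter the notion of a morphism, are not recorded. -/
structure RightDGModule (Q : A.HomologicalVF) extends GradedPresheaf.{u, w} M where
  /-- the multiplication `η ξ` of elements by functions -/
  rmul : ∀ U p a, deg U p →ₗ[ℝ] A.deg U a →ₗ[ℝ] deg U (p + a)
  /-- the differential -/
  D : ∀ U p, deg U p →ₗ[ℝ] deg U (p + 1)
  rmul_one : ∀ U p (η : deg U p), (rmul U p 0 η (A.one U)).1 = η.1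
  rmul_mul : ∀ U p a b (η : deg U p) (ξ : A.deg U a) (ζ : A.deg U b),
    (rmul U p (a + b) η (A.mul ξ ζ)).1 = (rmul U (p + a) b (rmul U p a η ξ) ζ).1
  rmul_res : ∀ {U V : Opens M} (h : V ≤ U) (p a : ℤ) (η : deg U p) (ξ : A.deg U a),
    (rmul V p a (toGradedPresheaf.resDeg h p η) (A.resDeg h a ξ)).1 = res h (rmul U p a η ξ).1
  D_res : ∀ {U V : Opens M} (h : V ≤ U) (p : ℤ) (η : deg U p),
    (D V p (toGradedPresheaf.resDeg h p η)).1 = res h (D U p η).1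
  D_D : ∀ U p (η : deg U p), (D U (p + 1) (D U p η)).1 = 0
  leibniz : ∀ U p a (η : deg U p) (ξ : A.deg U a),
    (D U (p + a) (rmul U p a η ξ)).1 =
      (rmul U (p + 1) a (D U p η) ξ).1 + sgn p • (rmul U p (a + 1) η (Q.act U a ξ)).1

namespace LeftDGModule

variable {Q : A.HomologicalVF} (E : LeftDGModule.{u, v, w} Q)

theorem smul_congr (U : Opens M) {a b p q : ℤ} (hab : a = b) (hpq : p = q) {ξ : A.deg U a}
    {ζ : A.deg U b} (h : ξ.1 = ζ.1) {η : E.deg U p} {η' : E.deg U q} (h' : η.1 = η'.1) :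
    (E.smul U a p ξ η).1 = (E.smul U b q ζ η').1 := by
  subst hab hpq
  rw [Subtype.ext h, Subtype.ext h']

theorem D_congr (U : Opens M) {p q : ℤ} (hpq : p = q) {η : E.deg U p} {η' : E.deg U q}
    (h : η.1 = η'.1) : (E.D U p η).1 = (E.D U q η').1 := by
  subst hpq
  rw [Subtype.ext h]

/-- The shift `E[k] = E ⊗ ℝ[k]` of a left module: multiplication and differential are those of
`E`. -/
def shift (k : ℤ) : LeftDGModule.{u, v, w} Q where
  toGradedPresheaf := E.toGradedPresheaf.shift k
  smul U a p := (E.smul U a (p + k)).compr₂ (E.cast U (add_assoc a p k).symm)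
  D U p := E.cast U (add_right_comm p k 1) ∘ₗ E.D U (p + k)
  one_smul U p η := E.one_smul U (p + k) η
  mul_smul U a b p ξ ζ η := (E.mul_smul U a b (p + k) ξ ζ η).trans
    (E.smul_congr U rfl (add_assoc b p k).symm rfl rfl)
  smul_res h a p ξ η := E.smul_res h a (p + k) ξ η
  D_res h p η := E.D_res h (p + k) η
  D_D U p η := (E.D_congr U (add_right_comm p 1 k) rfl).trans (E.D_D U (p + k) η)
  leibniz U a p ξ η := (E.D_congr U (add_assoc a p k) rfl).trans
    ((E.leibniz U a (p + k) ξ η).trans (congrArg (_ + sgn a • ·)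
      (E.smul_congr U rfl (add_right_comm p k 1) rfl rfl)))

/-- A degree preserving map `f` is an anti-morphism of left modules if it is odd linear,
`f(ξη) = (-1)^{|ξ|} ξ f(η)`, and anticommutes with the differentials. Anti-morphisms of degree `k`
from `E` to `F` are the anti-morphisms from `E` to `F[k]`. -/
def IsAntiHom {E F : LeftDGModule.{u, v, w} Q}
    (f : GradedPresheaf.Hom E.toGradedPresheaf F.toGradedPresheaf) : Prop :=
  (∀ U a p (ξ : A.deg U a) (η : E.deg U p),
    (f.toFun U (a + p) (E.smul U a p ξ η)).1 = sgn a • (F.smul U a p ξ (f.toFun U p η)).1) ∧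
  (∀ U p (η : E.deg U p),
    (f.toFun U (p + 1) (E.D U p η)).1 = -(F.D U p (f.toFun U p η)).1)

end LeftDGModule

namespace RightDGModule

variable {Q : A.HomologicalVF} (E : RightDGModule.{u, v, w} Q)

theorem rmul_congr (U : Opens M) {a b p q : ℤ} (hab : a = b) (hpq : p = q) {ξ : A.deg U a}
    {ζ : A.deg U b} (h : ξ.1 = ζ.1) {η : E.deg U p} {η' : E.deg U q} (h' : η.1 = η'.1) :
    (E.rmul U p a η ξ).1 = (E.rmul U q b η' ζ).1 := by
  subst hab hpq
  rw [Subtype.ext h, Subtype.ext h']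

theorem D_congr (U : Opens M) {p q : ℤ} (hpq : p = q) {η : E.deg U p} {η' : E.deg U q}
    (h : η.1 = η'.1) : (E.D U p η).1 = (E.D U q η').1 := by
  subst hpq
  rw [Subtype.ext h]

theorem shift_one (U : Opens M) (k p : ℤ) (η : E.deg U p) :
    sgn (k * 0) • (E.rmul U p 0 η (A.one U)).1 = η.1 := by
  rw [E.rmul_one, sgn_even (by simp), one_smul]

theorem shift_mul (U : Opens M) (k p a b : ℤ) (η : E.deg U (p + k)) (ξ : A.deg U a)
    (ζ : A.deg U b) :
    sgn (k * (a + b)) • (E.rmul U (p + k) (a + b) η (A.mul ξ ζ)).1 = sgn (k * b) •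
      (E.rmul U (p + a + k) b
        (sgn (k * a) • E.cast U (add_right_comm p k a) (E.rmul U (p + k) a η ξ)) ζ).1 := by
  rw [E.rmul_mul, map_smul, LinearMap.smul_apply, Submodule.coe_smul, smul_smul, ← sgn_add]
  exact congrArg₂ (· • ·) (congrArg sgn (by ring))
    (E.rmul_congr U rfl (add_right_comm p k a) rfl rfl)

theorem shift_leibniz (U : Opens M) (k p a : ℤ) (η : E.deg U (p + k)) (ξ : A.deg U a) :
    (E.D U (p + a + k)
        (sgn (k * a) • E.cast U (add_right_comm p k a) (E.rmul U (p + k) a η ξ))).1 =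
      sgn (k * a) •
          (E.rmul U (p + 1 + k) a (E.cast U (add_right_comm p k 1) (E.D U (p + k) η)) ξ).1 +
        sgn p • sgn (k * (a + 1)) • (E.rmul U (p + k) (a + 1) η (Q.act U a ξ)).1 := by
  rw [map_smul, Submodule.coe_smul, E.D_congr U (add_right_comm p a k)
    (η' := E.rmul U (p + k) a η ξ) rfl, E.leibniz, smul_add, smul_smul, smul_smul, ← sgn_add,
    ← sgn_add]
  refine congrArg₂ (· + ·) (congrArg (sgn (k * a) • ·)
    (E.rmul_congr U rfl (add_right_comm p k 1) rfl rfl))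
    (congrArg (· • (E.rmul U (p + k) (a + 1) η (Q.act U a ξ)).1) (sgn_congr ?_))
  simp only [Int.even_add, Int.even_mul, Int.not_even_one]
  by_cases Even a <;> by_cases Even p <;> by_cases Even k <;> simp [*]

/-- The shift `E[k] = E ⊗ ℝ[k]` of a right module: the differential is that of `E`, and
`(η ⊗ 1) ξ = (-1)^{k|ξ|} ηξ ⊗ 1`. -/
def shift (k : ℤ) : RightDGModule.{u, v, w} Q where
  toGradedPresheaf := E.toGradedPresheaf.shift k
  rmul U p a := sgn (k * a) •
    (E.rmul U (p + k) a).compr₂ (E.cast U (add_right_comm p k a))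
  D U p := E.cast U (add_right_comm p k 1) ∘ₗ E.D U (p + k)
  rmul_one U p η := E.shift_one U k (p + k) η
  rmul_mul U p a b η ξ ζ := E.shift_mul U k p a b η ξ ζ
  rmul_res h p a η ξ := (congrArg (sgn (k * a) • ·) (E.rmul_res h (p + k) a η ξ)).trans
    (map_smul _ _ _).symm
  D_res h p η := E.D_res h (p + k) η
  D_D U p η := (E.D_congr U (add_right_comm p 1 k) rfl).trans (E.D_D U (p + k) η)
  leibniz U p a η ξ := E.shift_leibniz U k p a η ξ

/-- A degree preserving map `f` is a morphism of right modules if it is linear,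
`f(ηξ) = f(η) ξ`, and commutes with the differentials. Morphisms of degree `k` from `E` to `F` are
the morphisms from `E` to `F[k]`. -/
def IsHom {E F : RightDGModule.{u, v, w} Q}
    (f : GradedPresheaf.Hom E.toGradedPresheaf F.toGradedPresheaf) : Prop :=
  (∀ U p a (η : E.deg U p) (ξ : A.deg U a),
    (f.toFun U (p + a) (E.rmul U p a η ξ)).1 = (F.rmul U p a (f.toFun U p η) ξ).1) ∧
  (∀ U p (η : E.deg U p),
    (f.toFun U (p + 1) (E.D U p η)).1 = (F.D U p (f.toFun U p η)).1)

end RightDGModule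

namespace LeftDGModule

variable {Q : A.HomologicalVF} (E : LeftDGModule.{u, v, w} Q)

theorem smul_mul_comm (U : Opens M) (a b p : ℤ) (ξ : A.deg U a) (ζ : A.deg U b)
    (η : E.deg U p) : (E.smul U (a + b) p (A.mul ξ ζ) η).1 =
      sgn (a * b) • (E.smul U b (a + p) ζ (E.smul U a p ξ η)).1 := by
  have h : A.mul ξ ζ = sgn (a * b) • Submodule.inclusion (add_comm b a ▸ le_rfl) (A.mul ζ ξ) :=
    Subtype.ext (A.comm U a b ξ.1 ξ.2 ζ.1 ζ.2)
  rw [h, map_smul, LinearMap.smul_apply, Submodule.coe_smul, ← E.mul_smul]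
  exact congrArg (_ • ·) (E.smul_congr U (add_comm a b) rfl rfl rfl)

/-- The right differential graded module given by a left one, with right multiplication
`ηξ = (-1)^{|ξ|(|η| + s)} ξη` and differential `(-1)^s D`. -/
def toRight (s : ℤ) : RightDGModule.{u, v, w} Q where
  toGradedPresheaf := E.toGradedPresheaf
  rmul U p a := sgn (a * (p + s)) • (E.smul U a p).flip.compr₂ (E.cast U (add_comm a p))
  D U p := sgn s • E.D U p
  rmul_one U p η := by
    change sgn (0 * (p + s)) • (E.smul U 0 p (A.one U) η).1 = η.1
    rw [E.one_smul, sgn_even (by simp), _root_.one_smul]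
  rmul_mul U p a b η ξ ζ := by
    change sgn ((a + b) * (p + s)) • (E.smul U (a + b) p (A.mul ξ ζ) η).1 =
      sgn (b * (p + a + s)) • (E.smul U b (p + a) ζ
        (sgn (a * (p + s)) • E.cast U (add_comm a p) (E.smul U a p ξ η))).1
    rw [E.smul_mul_comm, map_smul, Submodule.coe_smul, smul_smul, smul_smul, ← sgn_add,
      ← sgn_add]
    refine congrArg₂ (· • ·) (sgn_congr ?_) (E.smul_congr U rfl (add_comm a p) rfl rfl)
    simp only [Int.even_add, Int.even_mul]
    by_cases Even a <;> by_cases Even b <;> by_cases Even p <;> by_cases Even s <;> simp [*]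
  rmul_res h p a η ξ := (congrArg (sgn (a * (p + s)) • ·) (E.smul_res h a p ξ η)).trans
    (map_smul _ _ _).symm
  D_res h p η := (congrArg (sgn s • ·) (E.D_res h p η)).trans (map_smul _ _ _).symm
  D_D U p η := by
    change sgn s • (E.D U (p + 1) (sgn s • E.D U p η)).1 = 0
    rw [map_smul, Submodule.coe_smul, E.D_D, smul_zero, smul_zero]
  leibniz U p a η ξ := by
    change sgn s • (E.D U (p + a) (sgn (a * (p + s)) • E.cast U (add_comm a p) (E.smul U a p ξ η))).1 =
      sgn (a * (p + 1 + s)) • (E.smul U a (p + 1) ξ (sgn s • E.D U p η)).1 +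
        sgn p • sgn ((a + 1) * (p + s)) • (E.smul U (a + 1) p (Q.act U a ξ) η).1
    rw [map_smul, map_smul, Submodule.coe_smul, Submodule.coe_smul,
      E.D_congr U (add_comm p a) (η' := E.smul U a p ξ η) rfl, E.leibniz]
    simp only [smul_add, smul_smul, ← sgn_add]
    refine (add_comm _ _).trans ?_
    congr 2
    all_goals
      apply sgn_congr
      simp only [Int.even_add, Int.even_mul, Int.not_even_one]
      by_cases Even a <;> by_cases Even p <;> by_cases Even s <;> simp [*]

end LeftDGModule

/-! ### The adjoint and coadjoint modules -/

variable (A) in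
/-- the vector fields on an `[n]`-manifold -/
def vfPresheaf : GradedPresheaf.{u, max u v} M where
  amb := A.PreVF
  deg := A.vf
  res h := A.resPreVF h
  res_mem h j := A.resPreVF_mem h j
  res_id _ _ := rfl
  res_res _ _ _ := rfl

variable (A) in
/-- the one-forms on an `[n]`-manifold -/
def formsPresheaf : GradedPresheaf.{u, max u v} M where
  amb := A.PreForm
  deg := A.forms
  res h := A.resPreForm h
  res_mem h p := A.resPreForm_mem h p
  res_id _ _ := rfl
  res_res _ _ _ := rfl

/-- The adjoint module `(𝔛, L_Q)` as a left module. -/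
def adjointLeft (Q : A.HomologicalVF) : LeftDGModule.{u, v, max u v} Q where
  toGradedPresheaf := vfPresheaf A
  smul := A.smulVF
  D := Q.lieVF
  one_smul U j X := by
    refine funext fun V => LinearMap.ext fun ζ => ?_
    refine (A.smulVF_apply U 0 j (A.one U) X V ζ).trans ?_
    change A.res _ 1 * _ = _
    rw [map_one, one_mul]
  mul_smul U a b j ξ ζ X := by
    refine funext fun V => LinearMap.ext fun η => ?_
    refine (A.smulVF_apply U (a + b) j (A.mul ξ ζ) X V η).trans ?_
    change A.res (NManifold.le_base V) (ξ.1 * ζ.1) * X.1 V η =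
      A.res (NManifold.le_base V) ξ.1 * (A.res (NManifold.le_base V) ζ.1 * X.1 V η)
    rw [map_mul, mul_assoc]
  smul_res h a j ξ X := by
    refine funext fun V => LinearMap.ext fun η => ?_
    exact congrArg (· * X.1 ⟨V.1, le_trans V.2 h⟩ η) (A.res_res h (NManifold.le_base V) ξ.1)
  D_res h j X := congrArg Subtype.val (Q.lieVF_res h j X)
  D_D := Q.lieVF_lieVF
  leibniz := Q.lieVF_smul

/-- The coadjoint module `(Ω¹, L_Q)` as a left module. -/
def coadjointLeft (Q : A.HomologicalVF) : LeftDGModule.{u, v, max u v} Q where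
  toGradedPresheaf := formsPresheaf A
  smul := A.smulForm
  D := Q.lieForm
  one_smul U p θ := by
    refine funext fun V => funext fun j => LinearMap.ext fun X => ?_
    refine (A.smulForm_apply U 0 p (A.one U) θ V j X).trans ?_
    change sgn (0 * (j - 1)) • (A.res _ 1 * _) = _
    rw [map_one, one_mul, sgn_even (by simp), one_smul]
  mul_smul U a b p ξ ζ θ := by
    refine funext fun V => funext fun j => LinearMap.ext fun X => ?_
    refine (A.smulForm_apply U (a + b) p (A.mul ξ ζ) θ V j X).trans ?_
    change sgn ((a + b) * (j - 1)) • (A.res (NManifold.le_base V) (ξ.1 * ζ.1) * θ.1 V j X) =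
      sgn (a * (j - 1)) • (A.res (NManifold.le_base V) ξ.1 *
        (sgn (b * (j - 1)) • (A.res (NManifold.le_base V) ζ.1 * θ.1 V j X)))
    rw [map_mul, mul_assoc, mul_smul_comm, smul_smul, ← sgn_add, add_mul]
  smul_res h a p ξ θ := by
    refine funext fun V => funext fun j => LinearMap.ext fun X => ?_
    exact congrArg (fun x => sgn (a * (j - 1)) • (x * θ.1 ⟨V.1, le_trans V.2 h⟩ j X))
      (A.res_res h (NManifold.le_base V) ξ.1)
  D_res h p θ := rfl
  D_D := Q.lieForm_lieForm
  leibniz := Q.lieForm_smul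

/-- The adjoint module `(𝔛, L_Q)` as a right module, with `Xξ = (-1)^{|ξ||X|} ξX`. -/
def adjointRight (Q : A.HomologicalVF) : RightDGModule.{u, v, max u v} Q :=
  (adjointLeft Q).toRight 0

/-- The coadjoint module `(Ω¹, -L_Q)` as a right module, with
`θξ = (-1)^{|ξ|(|θ| + 1)} ξθ`, a form of degree `|θ|` having total degree `|θ| + 1`. -/
def coadjointRight (Q : A.HomologicalVF) : RightDGModule.{u, v, max u v} Q :=
  (coadjointLeft Q).toRight 1

/-- The map `♯` as a map of degree `k` from one-forms to vector fields. -/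
def sharpHom {k : ℤ} (P : A.PoissonBracket k) :
    GradedPresheaf.Hom (formsPresheaf A) ((vfPresheaf A).shift k) where
  toFun := P.sharp
  naturality h p θ := P.sharp_res h p θ

/-- A homological vector field and a degree `k` Poisson bracket are compatible. -/
def Compatible {k : ℤ} (Q : A.HomologicalVF) (P : A.PoissonBracket k) : Prop :=
  ∀ (U : Opens M) (a : ℤ), ∀ ξ ∈ A.deg U a, ∀ ζ : A.sec U,
    NManifold.ap (Q.on U) (P.bracket U ξ ζ) =
      P.bracket U (NManifold.ap (Q.on U) ξ) ζ +
        sgn (a + k) • P.bracket U ξ (NManifold.ap (Q.on U) ζ)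

/-- An `[n]`-manifold with a homological vector field `Q` and a degree `-n` Poisson bracket is a
Poisson Lie `n`-algebroid if the two structures are compatible. -/
def IsPoissonLieAlgebroid (Q : A.HomologicalVF) (P : A.PoissonBracket (-(n : ℤ))) : Prop :=
  Compatible Q P

end Modules

end Manifold

end GradedGeometry

end

/-!
All three equivalences rest on one reformulation of compatibility: `Q` is compatible with the
bracket exactly when `[Q, X_ξ] = X_{Qξ}` for every Hamiltonian vector field `X_ξ = {ξ, ·}`
(`compatible_iff_lieVF_ham`).

The contraction formula `(♯θ)(ξ) = ± θ(X_ξ)` together with Cartan's formula for `L_Q θ` turns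
`♯ (L_Q θ) = -L_Q (♯ θ)`, evaluated at `ξ`, into `θ([Q, X_ξ]) = θ(X_{Qξ})`; this gives the
anticommutation of `♯` with the Lie derivatives from compatibility. Conversely, on the exact form
`θ = dξ` one has `L_Q (dξ) = -d(Qξ)` and `♯(dξ) = X_ξ`, so that anticommutation on exact forms
already says `X_{Qξ} = [Q, X_ξ]` (`compatible_iff_sharp_lieForm`).

Finally `♯` is odd linear over functions for every Poisson bracket, compatible or not. With the
conventions for right multiplication and for shifts, odd linearity on the left is the same as
linearity on the right (`sharp_rmul`). Being an anti-morphism of left modules or a morphism of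
right modules is hence a condition on the differentials only, and since the differential of the
right coadjoint module is `-L_Q`, it is in both cases anticommutation with the Lie derivatives.
-/

open TopologicalSpace
open scoped Manifold ContDiff

namespace GradedGeometry

universe u v

variable {m n : ℕ} {r : Fin n → ℕ} {M : Type u} [TopologicalSpace M]
  [ChartedSpace (EuclideanSpace ℝ (Fin m)) M] {A : NManifold.{u, v} (m := m) r M}
  {k : ℤ} (Q : A.HomologicalVF) (P : A.PoissonBracket k)

open NManifold

/-- Compatibility of `Q` with the bracket means `[Q, {ξ, ·}] = {Qξ, ·}`. -/
theorem compatible_iff_lieVF_ham :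
    Compatible Q P ↔ ∀ (U : Opens M) (a : ℤ) (ξ : A.deg U a),
      (Q.lieVF U (a + k) (P.ham U a ξ)).1 = (P.ham U (a + 1) (Q.act U a ξ)).1 := by
  constructor
  · intro h U a ξ
    refine funext fun V => LinearMap.ext fun ζ => ?_
    have hQ : A.res (le_base V) (Q.act U a ξ).1 = ap (Q.on V.1) (A.res (le_base V) ξ.1) :=
      (ap_res (le_base V) (Q.on U) ξ.1).symm
    rw [Q.lieVF_apply, P.ham_apply, P.ham_apply, P.ham_apply, hQ,
      h V.1 a _ (A.res_mem (le_base V) a ξ.1 ξ.2) ζ, add_sub_cancel_right]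
  · intro h U a ξ hξ ζ
    have e := LinearMap.congr_fun (congrFun (h U a ⟨ξ, hξ⟩) ⟨U, le_refl U⟩) ζ
    rw [Q.lieVF_apply, P.ham_apply, P.ham_apply, P.ham_apply, A.res_id, A.res_id] at e
    exact sub_eq_iff_eq_add.1 e

/-- The signs in the contraction formulas for `♯ (L_Q θ)` and `-L_Q (♯ θ)` agree: here `x` stands
for `Q(θ(X_ξ))` and `y` for `θ([Q, X_ξ]) = θ(X_{Qξ})`. -/
theorem sharp_lieForm_signs {N : Type*} [AddCommGroup N] [Module ℝ N] (a p k : ℤ) (x y : N) :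
    -sgn ((a + k) * (p + 1 + k)) • sgn (a + k - 1) • (x - y) =
      -(-sgn ((a + k) * (p + k)) • x -
        sgn (p + k) • -sgn ((a + 1 + k) * (p + k)) • y) := by
  have h1 : sgn ((a + k) * (p + 1 + k) + (a + k - 1)) = -sgn ((a + k) * (p + k)) := by
    rw [neg_sgn]
    apply sgn_congr
    simp only [Int.even_add, Int.even_mul, Int.even_sub, Int.not_even_one]
    by_cases Even a <;> by_cases Even p <;> by_cases Even k <;> simp [*]
  have h2 : sgn (p + k + (a + 1 + k) * (p + k)) = sgn ((a + k) * (p + k)) := by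
    apply sgn_congr
    simp only [Int.even_add, Int.even_mul, Int.not_even_one]
    by_cases Even a <;> by_cases Even p <;> by_cases Even k <;> simp [*]
  simp only [neg_smul, smul_neg, smul_smul, neg_mul, ← sgn_add, h1, h2, neg_neg, smul_sub]
  abel

/-- Compatibility of `Q` with the bracket means that `♯` anticommutes with the Lie derivatives. -/
theorem compatible_iff_sharp_lieForm :
    Compatible Q P ↔ ∀ (U : Opens M) (p : ℤ) (θ : A.forms U p),
      (P.sharp U (p + 1) (Q.lieForm U p θ)).1 = -(Q.lieVF U (p + k) (P.sharp U p θ)).1 := by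
  rw [compatible_iff_lieVF_ham]
  constructor
  · intro h U p θ
    refine funext fun V => A.hom_ext fun a ξ hξ => ?_
    have e1 := P.sharp_apply U (p + 1) (Q.lieForm U p θ) V a ⟨ξ, hξ⟩
    have e2 := P.sharp_apply U p θ V a ⟨ξ, hξ⟩
    have e3 := P.sharp_apply U p θ V (a + 1) (Q.act V.1 a ⟨ξ, hξ⟩)
    have e4 : θ.1 V (a + k + 1) (Q.lieVF V.1 (a + k) (P.ham V.1 a ⟨ξ, hξ⟩)) =
        θ.1 V (a + 1 + k) (P.ham V.1 (a + 1) (Q.act V.1 a ⟨ξ, hξ⟩)) :=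
      form_congr θ.1 V (add_right_comm a k 1) (h V.1 a ⟨ξ, hξ⟩)
    rw [Q.lieForm_apply, e4, sharp_lieForm_signs] at e1
    refine e1.trans ?_
    change _ = -((Q.lieVF U (p + k) (P.sharp U p θ)).1 V ξ)
    rw [Q.lieVF_apply]
    refine congrArg Neg.neg (congrArg₂ (fun x y => x - sgn (p + k) • y) ?_ e3.symm)
    exact ((congrArg (ap (Q.on V.1)) e2).trans (map_smul _ _ _)).symm
  · intro h U a ξ
    have e := h U a (A.d U a ξ)
    rw [Q.lieForm_d, map_neg, P.sharp_d, P.sharp_d] at e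
    exact (neg_injective e).symm

theorem sharp_smul_congr (U : Opens M) {p q : ℤ} (hpq : q = p) (c : ℝ) {θ : A.forms U p}
    {θ' : A.forms U q} (h : θ.1 = c • θ'.1) : (P.sharp U p θ).1 = c • (P.sharp U q θ').1 := by
  subst hpq
  rw [show θ = c • θ' from Subtype.ext h, map_smul, Submodule.coe_smul]

/-- `♯` is linear with respect to the right multiplications of the coadjoint module and of the
shifted adjoint module. -/
theorem sharp_rmul (U : Opens M) (p a : ℤ) (θ : A.forms U p) (ξ : A.deg U a) :
    (P.sharp U (p + a) ((coadjointRight Q).rmul U p a θ ξ)).1 =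
      (((adjointRight Q).shift k).rmul U p a (P.sharp U p θ) ξ).1 := by
  have hl := sharp_smul_congr P U (add_comm a p) (sgn (a * (p + 1)))
    (θ := (coadjointRight Q).rmul U p a θ ξ) (θ' := A.smulForm U a p ξ θ) rfl
  have hr : (((adjointRight Q).shift k).rmul U p a (P.sharp U p θ) ξ).1 =
    sgn (k * a) • sgn (a * (p + k + 0)) • (A.smulVF U a (p + k) ξ (P.sharp U p θ)).1 := rfl
  refine hl.trans (Eq.trans ?_ hr.symm)
  rw [P.sharp_smul, smul_smul, smul_smul, ← sgn_add, ← sgn_add]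
  refine congrArg (· • (A.smulVF U a (p + k) ξ (P.sharp U p θ)).1) (sgn_congr ?_)
  simp only [Int.even_add, Int.even_mul, Int.not_even_one, Even.zero]
  by_cases Even a <;> by_cases Even p <;> by_cases Even k <;> simp [*]

theorem compatible_iff_isAntiHom_sharpHom :
    Compatible Q P ↔ LeftDGModule.IsAntiHom (E := coadjointLeft Q)
      (F := (adjointLeft Q).shift k) (sharpHom P) := by
  rw [compatible_iff_sharp_lieForm]
  exact ⟨fun h => ⟨P.sharp_smul, h⟩, fun h => h.2⟩

theorem compatible_iff_isHom_sharpHom :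
    Compatible Q P ↔ RightDGModule.IsHom (E := coadjointRight Q)
      (F := (adjointRight Q).shift k) (sharpHom P) := by
  have hD : ∀ (U : Opens M) (p : ℤ) (θ : A.forms U p),
      (P.sharp U (p + 1) ((coadjointRight Q).D U p θ)).1 =
          (((adjointRight Q).shift k).D U p (P.sharp U p θ)).1 ↔
        (P.sharp U (p + 1) (Q.lieForm U p θ)).1 = -(Q.lieVF U (p + k) (P.sharp U p θ)).1 := by
    intro U p θ
    change (P.sharp U (p + 1) (sgn 1 • Q.lieForm U p θ)).1 =
      sgn 0 • (Q.lieVF U (p + k) (P.sharp U p θ)).1 ↔ _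
    rw [map_smul, Submodule.coe_smul, show sgn 1 = -1 by simp [sgn], sgn_even Even.zero, one_smul,
      neg_one_smul, neg_eq_iff_eq_neg]
  rw [compatible_iff_sharp_lieForm]
  exact ⟨fun h => ⟨sharp_rmul Q P, fun U p θ => (hD U p θ).2 (h U p θ)⟩,
    fun h U p θ => (hD U p θ).1 (h.2 U p θ)⟩

end GradedGeometry

theorem mainTheorem1 {m n : ℕ} {r : Fin n → ℕ} {M : Type*} [TopologicalSpace M] [T2Space M]
    [SecondCountableTopology M] [ChartedSpace (EuclideanSpace ℝ (Fin m)) M]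
    [IsManifold (𝓡 m) ∞ M] (A : GradedGeometry.NManifold (m := m) r M)
    (Q : A.HomologicalVF) (P : A.PoissonBracket (-(n : ℤ))) :
    (GradedGeometry.IsPoissonLieAlgebroid Q P ↔
      GradedGeometry.LeftDGModule.IsAntiHom (E := GradedGeometry.coadjointLeft Q)
        (F := (GradedGeometry.adjointLeft Q).shift (-(n : ℤ))) (GradedGeometry.sharpHom P)) ∧
    (GradedGeometry.IsPoissonLieAlgebroid Q P ↔
      GradedGeometry.RightDGModule.IsHom (E := GradedGeometry.coadjointRight Q)
        (F := (GradedGeometry.adjointRight Q).shift (-(n : ℤ))) (GradedGeometry.sharpHom P)) ∧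
    (GradedGeometry.IsPoissonLieAlgebroid Q P ↔
      ∀ (U : TopologicalSpace.Opens M) (p : ℤ) (θ : A.forms U p),
        (P.sharp U (p + 1) (Q.lieForm U p θ)).1 =
          -(Q.lieVF U (p + -(n : ℤ)) (P.sharp U p θ)).1) :=
  ⟨GradedGeometry.compatible_iff_isAntiHom_sharpHom Q P,
    GradedGeometry.compatible_iff_isHom_sharpHom Q P,
    GradedGeometry.compatible_iff_sharp_lieForm Q P⟩
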